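/- Let $\mathcal A$ and $\mathcal B$ be categories with equalizers and let $P:\mathcal A\to\mathcal B$, $Q:\mathcal B\to\mathcal A$, $R:\mathcal A\to\mathcal A$, $S:\mathcal B\to\mathcal B$ be functors that preserve equalizers. Composition of functors is written by juxtaposition ($QP:\mathcal A\to\mathcal A$, etc.), the identity functor of $\mathcal A$ is denoted $\mathcal A$, and the identity transformation of a functor $F$ is denoted $F$. Let $$r:\mathcal A\to R,\quad s:\mathcal B\to S,\quad w:QP\to R,\quad z:PQ\to S,\quad \tau:Q\to QPQ$$ be natural transformations such that (i) $r$ is the equalizer of $rR,Rr:R\to RR$, and $s$ is the equalizer of $sS,Ss:S\to SS$ (in the categories of functors and natural transformations); (ii) $(QP\tau)\circ\tau=(\tau PQ)\circ\tau$; (iii) $(Qz)\circ\tau=Qs$ and $(wQ)\circ\tau=rQ$. Put $\omega^l=(QPw)\circ(\tau P)$ and $\omega^r=QPr$ (transformations $QP\to QPR$), $\theta^l=(zPQ)\circ(P\tau)$ and $\theta^r=sPQ$ (transformations $PQ\to SPQ$). Let $i:C\to QP$ be the equalizer of $\omega^l,\omega^r$, and $j:D\to PQ$ the equalizer of $\theta^l,\theta^r$;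 the functors $C$ and $D$ preserve equalizers. Then $C$ underlies a comonad $\mathbb C=(C,\Delta^C,\varepsilon^C)$ on $\mathcal A$ and $D$ a comonad $\mathbb D=(D,\Delta^D,\varepsilon^D)$ on $\mathcal B$, determined by $$ii\circ\Delta^C=(\tau P)\circ i,\quad r\circ\varepsilon^C=w\circ i,\quad jj\circ\Delta^D=(P\tau)\circ j,\quad s\circ\varepsilon^D=z\circ j,$$ where $ii:CC\to QPQP$ and $jj:DD\to PQPQ$ are the horizontal composites. The functor $Q$ is a $\mathbb C$-$\mathbb D$ bicomodule functor (a functor with commuting left $\mathbb C$- and right $\mathbb D$-coactions), with the coactions $c:Q\to CQ$ and $d:Q\to QD$ determined by $(iQ)\circ c=\tau$ and $(Qj)\circ d=\tau$. Let $q:\overline Q\to PC$ be the equalizer of $(\theta^lP)\circ(Pi)$ and $(\theta^rP)\circ(Pi)$, and let $q':\overline Q\to DP$ be the transformation determined by $(jP)\circ q'=(Pi)\circ q$; it is an equalizer of $(P\omega^l)\circ(jP)$ and $(P\omega^r)\circ(jP)$. The functor $\overline Q:\mathcal A\to\mathcal B$ is a $\mathbb D$-$\mathbb C$ bicomodule functor,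 with the right coaction $\overline c:\overline Q\to\overline QC$ and the left coaction $\overline d:\overline Q\to D\overline Q$ determined by $(qC)\circ\overline c=(P\Delta^C)\circ q$ and $(Dq')\circ\overline d=(\Delta^DP)\circ q'$. Let $\mathcal A^{\mathbb C}$ and $\mathcal B^{\mathbb D}$ be the categories of comodules (Eilenberg–Moore coalgebras). The bicomodule functor $Q$ induces the cotensor functor $I_Q:\mathcal B^{\mathbb D}\to\mathcal A^{\mathbb C}$: it sends a $\mathbb D$-comodule $(Y,\varrho)$ to the equalizer $e:I_0\to QY$ of $dY$ and $Q\varrho:QY\to QDY$, with the $\mathbb C$-coaction $c_0:I_0\to CI_0$ determined by $(Ce)\circ c_0=(cY)\circ e$, and acts on morphisms by the universal property of the equalizer. In the same way $\overline Q$ induces $I_{\overline Q}:\mathcal A^{\mathbb C}\to\mathcal B^{\mathbb D}$. Then $I_Q$ and $I_{\overline Q}$ are inverse equivalences of categories between $\mathcal B^{\mathbb D}$ and $\mathcal A^{\mathbb C}$. -/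

import Mathlib

open CategoryTheory CategoryTheory.Limits

/-! ### Equalizers -/

/-- The morphism `i` is an equalizer of the parallel pair `f`, `g`. -/
def IsEqualizer {K : Type*} [Category K] {E X Y : K} (i : E ⟶ X) (f g : X ⟶ Y) : Prop :=
  ∃ w : i ≫ f = i ≫ g, Nonempty (IsLimit (Fork.ofι i w))

/-- The functor `F` preserves equalizers. -/
abbrev PreservesEqualizers {K L : Type*} [Category K] [Category L] (F : K ⥤ L) : Prop :=
  PreservesLimitsOfShape WalkingParallelPair F

namespace IsEqualizer

section

variable {K : Type*} [Category K] {E X Y : K} {i : E ⟶ X} {f g : X ⟶ Y}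

theorem condition (h : IsEqualizer i f g) : i ≫ f = i ≫ g := h.1

theorem cancel (h : IsEqualizer i f g) {W : K} {k l : W ⟶ E} (e : k ≫ i = l ≫ i) : k = l :=
  Fork.IsLimit.hom_ext h.2.some e

theorem mono (h : IsEqualizer i f g) : Mono i := ⟨fun _ _ e => h.cancel e⟩

/-- The factorization of a morphism through an equalizer. -/
noncomputable def lift (h : IsEqualizer i f g) {W : K} (k : W ⟶ X) (e : k ≫ f = k ≫ g) : W ⟶ E :=
  Fork.IsLimit.lift h.2.some k e

theorem lift_comp (h : IsEqualizer i f g) {W : K} (k : W ⟶ X) (e : k ≫ f = k ≫ g) :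
    h.lift k e ≫ i = k :=
  Fork.IsLimit.lift_ι h.2.some

theorem intro (w : i ≫ f = i ≫ g) (hm : Mono i)
    (hl : ∀ {W : K} (k : W ⟶ X), k ≫ f = k ≫ g → ∃ l : W ⟶ E, l ≫ i = k) : IsEqualizer i f g :=
  ⟨w, ⟨Fork.IsLimit.mk _ (fun s => (hl s.ι s.condition).choose)
    (fun s => (hl s.ι s.condition).choose_spec)
    (fun s _ hms => hm.right_cancellation _ _
      (hms.trans (hl s.ι s.condition).choose_spec.symm))⟩⟩

theorem map (h : IsEqualizer i f g) {L : Type*} [Category L] (F : K ⥤ L) [PreservesEqualizers F] :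
    IsEqualizer (F.map i) (F.map f) (F.map g) :=
  ⟨by rw [← F.map_comp, ← F.map_comp, h.condition],
    ⟨isLimitForkMapOfIsLimit F h.condition h.2.some⟩⟩

theorem equalizer_ι {K : Type*} [Category K] {X Y : K} (f g : X ⟶ Y) [HasEqualizer f g] :
    IsEqualizer (equalizer.ι f g) f g :=
  ⟨equalizer.condition f g, ⟨equalizerIsEqualizer f g⟩⟩

end

/-- Equalizers of natural transformations are computed objectwise. -/
theorem app {K L : Type*} [Category K] [Category L] [HasEqualizers L] {E F G : K ⥤ L}
    {i : E ⟶ F} {f g : F ⟶ G} (h : IsEqualizer i f g) (X : K) :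
    IsEqualizer (i.app X) (f.app X) (g.app X) :=
  h.map ((evaluation K L).obj X)

/-- The factorization of a natural transformation through an objectwise equalizer. -/
noncomputable def natLift {K L : Type*} [Category K] [Category L] {H E F : K ⥤ L} {i : E ⟶ F}
    {T : K → L} {f g : ∀ X, F.obj X ⟶ T X} (h : ∀ X, IsEqualizer (i.app X) (f X) (g X))
    (k : H ⟶ F) (e : ∀ X, k.app X ≫ f X = k.app X ≫ g X) : H ⟶ E where
  app X := (h X).lift (k.app X) (e X)
  naturality _ Y _ := (h Y).cancel (by
    rw [Category.assoc, Category.assoc, lift_comp, i.naturality, k.naturality, ← Category.assoc,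
      lift_comp])

theorem natLift_app {K L : Type*} [Category K] [Category L] {H E F : K ⥤ L} {i : E ⟶ F}
    {T : K → L} {f g : ∀ X, F.obj X ⟶ T X} (h : ∀ X, IsEqualizer (i.app X) (f X) (g X))
    (k : H ⟶ F) (e : ∀ X, k.app X ≫ f X = k.app X ≫ g X) (X : K) :
    (natLift h k e).app X ≫ i.app X = k.app X :=
  lift_comp (h X) _ _

/-- A functor that is the equalizer of natural transformations between equalizer preserving
functors preserves equalizers. -/
theorem preserves {K L : Type*} [Category K] [Category L] [HasEqualizers K] [HasEqualizers L]
    {E F G : K ⥤ L} {i : E ⟶ F} {f g : F ⟶ G} (h : IsEqualizer i f g)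
    [PreservesEqualizers F] [PreservesEqualizers G] : PreservesEqualizers E := by
  refine ⟨fun {D} => ?_⟩
  suffices hs : ∀ {X Y : K} (a b : X ⟶ Y), PreservesLimit (parallelPair a b) E from
    preservesLimit_of_iso_diagram E (diagramIsoParallelPair D).symm
  intro X Y a b
  have hk := equalizer_ι a b
  have hF := hk.map F
  have hG := hk.map G
  have hE : IsEqualizer (E.map (equalizer.ι a b)) (E.map a) (E.map b) := by
    refine intro (by rw [← E.map_comp, ← E.map_comp, hk.condition]) ⟨fun u v e => ?_⟩
      fun {W} k e => ?_
    · apply (h.app _).cancel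
      apply hF.cancel
      rw [Category.assoc, Category.assoc, ← i.naturality, reassoc_of% e]
    · have e1 : (k ≫ i.app X) ≫ F.map a = (k ≫ i.app X) ≫ F.map b := by
        rw [Category.assoc, Category.assoc, ← i.naturality, ← i.naturality, reassoc_of% e]
      have e2 := hF.lift_comp _ e1
      set t := hF.lift _ e1
      have e3 : t ≫ f.app _ = t ≫ g.app _ := by
        apply hG.cancel
        rw [Category.assoc, Category.assoc, ← f.naturality, ← g.naturality, reassoc_of% e2,
          reassoc_of% e2, (h.app X).condition]
      refine ⟨(h.app _).lift t e3, (h.app X).cancel ?_⟩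
      rw [Category.assoc, i.naturality, ← Category.assoc, lift_comp, e2]
  exact preservesLimit_of_preserves_limit_cone (equalizerIsEqualizer a b)
    ((isLimitMapConeForkEquiv E (equalizer.condition a b)).symm hE.2.some)

end IsEqualizer

/-! ### Bicomodule functors and their cotensor functors -/

universe v₁ v₂ u₁ u₂

/-- A `C`-`D` bicomodule functor for comonads `C` on `A` and `D` on `B`: a functor `F : B ⥤ A`
with a left `C`-coaction and a right `D`-coaction that commute. -/
structure Bicomodule {A : Type u₁} [Category.{v₁} A] {B : Type u₂} [Category.{v₂} B]
    (C : Comonad A) (D : Comonad B) where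
  /-- the underlying functor -/
  F : B ⥤ A
  /-- the left coaction `F → C F` -/
  left : F ⟶ F ⋙ C.toFunctor
  /-- the right coaction `F → F D` -/
  right : F ⟶ D.toFunctor ⋙ F
  left_counit : ∀ Y, left.app Y ≫ C.ε.app (F.obj Y) = 𝟙 (F.obj Y)
  left_coassoc : ∀ Y, left.app Y ≫ C.δ.app (F.obj Y) = left.app Y ≫ C.map (left.app Y)
  right_counit : ∀ Y, right.app Y ≫ F.map (D.ε.app Y) = 𝟙 (F.obj Y)
  right_coassoc : ∀ Y, right.app Y ≫ F.map (D.δ.app Y) = right.app Y ≫ right.app (D.obj Y)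
  comm : ∀ Y, left.app Y ≫ C.map (right.app Y) = right.app Y ≫ left.app (D.obj Y)

namespace Bicomodule

variable {A : Type u₁} [Category.{v₁} A] {B : Type u₂} [Category.{v₂} B]
  {C : Comonad A} {D : Comonad B} (M : Bicomodule C D)

/-- The natural transformation `F U → F D U` given by the right coaction of `F`, where `U` is the
forgetful functor from `D`-comodules. -/
def coactRight : D.forget ⋙ M.F ⟶ D.forget ⋙ D.toFunctor ⋙ M.F where
  app X := M.right.app X.A
  naturality _ _ f := M.right.naturality f.f

/-- The natural transformation `F U → F D U` given by the coaction of `D`-comodules. -/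
def coactLeft : D.forget ⋙ M.F ⟶ D.forget ⋙ D.toFunctor ⋙ M.F where
  app X := M.F.map X.a
  naturality X Y f := by
    change M.F.map f.f ≫ M.F.map Y.a = M.F.map X.a ≫ M.F.map (D.map f.f)
    rw [← M.F.map_comp, ← M.F.map_comp, f.h]

/-- The functor underlying the cotensor functor: the equalizer of the two maps `F U → F D U`. -/
noncomputable def cotensorObj [HasEqualizers A] : D.Coalgebra ⥤ A :=
  equalizer M.coactRight M.coactLeft

/-- The inclusion of the cotensor product in `F U`. -/
noncomputable def cotensorι [HasEqualizers A] : M.cotensorObj ⟶ D.forget ⋙ M.F :=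
  equalizer.ι M.coactRight M.coactLeft

/-- The component of `cotensorι` at a comodule. -/
noncomputable def incl [HasEqualizers A] (X : D.Coalgebra) :
    M.cotensorObj.obj X ⟶ M.F.obj X.A :=
  M.cotensorι.app X

theorem incl_eq [HasEqualizers A] (X : D.Coalgebra) :
    IsEqualizer (M.incl X) (M.right.app X.A) (M.F.map X.a) :=
  (IsEqualizer.equalizer_ι M.coactRight M.coactLeft).app X

theorem incl_naturality [HasEqualizers A] {X Y : D.Coalgebra} (f : X ⟶ Y) :
    M.cotensorObj.map f ≫ M.incl Y = M.incl X ≫ M.F.map f.f :=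
  M.cotensorι.naturality f

theorem incl_left [HasEqualizers A] (X : D.Coalgebra) :
    (M.incl X ≫ M.left.app X.A) ≫ C.map (M.right.app X.A) =
      (M.incl X ≫ M.left.app X.A) ≫ C.map (M.F.map X.a) := by
  have h1 : M.F.map X.a ≫ M.left.app (D.obj X.A) = M.left.app X.A ≫ C.map (M.F.map X.a) :=
    M.left.naturality X.a
  have h2 := (M.incl_eq X).condition
  rw [Category.assoc, Category.assoc, M.comm, reassoc_of% h2, h1]

/-- The `C`-coaction on the cotensor product: the unique natural transformation whose composite
with `C` applied to the inclusion is the inclusion followed by the left coaction of `F`. -/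
noncomputable def cotensorCoact [HasEqualizers A] [PreservesEqualizers C.toFunctor] :
    M.cotensorObj ⟶ M.cotensorObj ⋙ C.toFunctor :=
  IsEqualizer.natLift (i := Functor.whiskerRight M.cotensorι C.toFunctor)
    (fun X => (M.incl_eq X).map C.toFunctor)
    (M.cotensorι ≫ Functor.whiskerLeft D.forget M.left) M.incl_left

theorem cotensorCoact_comp [HasEqualizers A] [PreservesEqualizers C.toFunctor]
    (X : D.Coalgebra) :
    M.cotensorCoact.app X ≫ C.map (M.incl X) = M.incl X ≫ M.left.app X.A :=
  IsEqualizer.natLift_app (i := Functor.whiskerRight M.cotensorι C.toFunctor)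
    (fun X => (M.incl_eq X).map C.toFunctor) _ _ X

/-- The cotensor functor from `D`-comodules to `C`-comodules induced by a `C`-`D` bicomodule
functor, for an equalizer preserving comonad `C`. -/
noncomputable def cotensor [HasEqualizers A] [PreservesEqualizers C.toFunctor] :
    D.Coalgebra ⥤ C.Coalgebra where
  obj X :=
    { A := M.cotensorObj.obj X
      a := M.cotensorCoact.app X
      counit := by
        apply (M.incl_eq X).cancel
        have h := Comonad.counit_naturality A C (M.incl X)
        have h2 := M.cotensorCoact_comp X
        rw [Category.assoc, ← h, reassoc_of% h2, M.left_counit, Category.comp_id,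
          Category.id_comp]
      coassoc := by
        apply (((M.incl_eq X).map C.toFunctor).map C.toFunctor).cancel
        have h := Comonad.delta_naturality A C (M.incl X)
        have h2 := M.cotensorCoact_comp X
        rw [Category.assoc, ← h, reassoc_of% h2, Category.assoc, ← C.map_comp, h2, C.map_comp,
          reassoc_of% h2, M.left_coassoc] }
  map {X Y} f :=
    { f := M.cotensorObj.map f
      h := (M.cotensorCoact.naturality f).symm }
  map_id X := by
    ext
    exact M.cotensorObj.map_id X
  map_comp f g := by
    ext
    exact M.cotensorObj.map_comp f g

end Bicomodule

/-! ### The setting -/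

/-- Equalizer preserving functors `P`, `Q`, `R`, `S` together with natural transformations
`r : A → R`, `s : B → S`, `w : QP → R`, `z : PQ → S` and `τ : Q → QPQ` such that
`r` is the equalizer of `rR` and `Rr`, `s` is the equalizer of `sS` and `Ss`,
`(QPτ)∘τ = (τPQ)∘τ`, `(Qz)∘τ = Qs` and `(wQ)∘τ = rQ`. -/
structure TorsorContext (A : Type u₁) [Category.{v₁} A] (B : Type u₂) [Category.{v₂} B] where
  P : A ⥤ B
  Q : B ⥤ A
  R : A ⥤ A
  S : B ⥤ B
  presP : PreservesEqualizers P
  presQ : PreservesEqualizers Q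
  presR : PreservesEqualizers R
  presS : PreservesEqualizers S
  r : 𝟭 A ⟶ R
  s : 𝟭 B ⟶ S
  w : P ⋙ Q ⟶ R
  z : Q ⋙ P ⟶ S
  τ : Q ⟶ Q ⋙ P ⋙ Q
  r_isEqualizer : IsEqualizer r
    (R.rightUnitor.inv ≫ Functor.whiskerLeft R r) (R.leftUnitor.inv ≫ Functor.whiskerRight r R)
  s_isEqualizer : IsEqualizer s
    (S.rightUnitor.inv ≫ Functor.whiskerLeft S s) (S.leftUnitor.inv ≫ Functor.whiskerRight s S)
  τ_coassoc : ∀ Y, τ.app Y ≫ Q.map (P.map (τ.app Y)) = τ.app Y ≫ τ.app (P.obj (Q.obj Y))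
  τ_z : ∀ Y, τ.app Y ≫ Q.map (z.app Y) = Q.map (s.app Y)
  τ_w : ∀ Y, τ.app Y ≫ w.app (Q.obj Y) = r.app (Q.obj Y)

namespace TorsorContext

set_option linter.unusedSectionVars false

attribute [instance] presP presQ presR presS

section

variable {A : Type u₁} [Category.{v₁} A] {B : Type u₂} [Category.{v₂} B] (T : TorsorContext A B)

theorem τ_nat {Y Y' : B} (f : Y ⟶ Y') :
    T.Q.map f ≫ T.τ.app Y' = T.τ.app Y ≫ T.Q.map (T.P.map (T.Q.map f)) :=
  T.τ.naturality f

theorem w_nat {X X' : A} (f : X ⟶ X') :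
    T.Q.map (T.P.map f) ≫ T.w.app X' = T.w.app X ≫ T.R.map f :=
  T.w.naturality f

theorem z_nat {Y Y' : B} (f : Y ⟶ Y') :
    T.P.map (T.Q.map f) ≫ T.z.app Y' = T.z.app Y ≫ T.S.map f :=
  T.z.naturality f

theorem r_nat {X X' : A} (f : X ⟶ X') : f ≫ T.r.app X' = T.r.app X ≫ T.R.map f :=
  T.r.naturality f

theorem s_nat {Y Y' : B} (f : Y ⟶ Y') : f ≫ T.s.app Y' = T.s.app Y ≫ T.S.map f :=
  T.s.naturality f

theorem r_eq [HasEqualizers A] (X : A) :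
    IsEqualizer (T.r.app X) (T.r.app (T.R.obj X)) (T.R.map (T.r.app X)) := by
  simpa using T.r_isEqualizer.app X

theorem s_eq [HasEqualizers B] (Y : B) :
    IsEqualizer (T.s.app Y) (T.s.app (T.S.obj Y)) (T.S.map (T.s.app Y)) := by
  simpa using T.s_isEqualizer.app Y

/-- `ω^l = (QPw)∘(τP) : QP → QPR`. -/
def ωl : T.P ⋙ T.Q ⟶ T.R ⋙ T.P ⋙ T.Q where
  app X := T.τ.app (T.P.obj X) ≫ T.Q.map (T.P.map (T.w.app X))
  naturality _ _ f := by
    change T.Q.map (T.P.map f) ≫ _ = _ ≫ T.Q.map (T.P.map (T.R.map f))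
    rw [reassoc_of% T.τ_nat, Category.assoc, ← T.Q.map_comp, ← T.P.map_comp, ← T.Q.map_comp,
      ← T.P.map_comp, T.w_nat]

/-- `ω^r = QPr : QP → QPR`. -/
def ωr : T.P ⋙ T.Q ⟶ T.R ⋙ T.P ⋙ T.Q where
  app X := T.Q.map (T.P.map (T.r.app X))
  naturality _ _ f := by
    change T.Q.map (T.P.map f) ≫ _ = _ ≫ T.Q.map (T.P.map (T.R.map f))
    rw [← T.Q.map_comp, ← T.P.map_comp, ← T.Q.map_comp, ← T.P.map_comp, T.r_nat]

/-- `θ^l = (zPQ)∘(Pτ) : PQ → SPQ`. -/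
def θl : T.Q ⋙ T.P ⟶ (T.Q ⋙ T.P) ⋙ T.S where
  app Y := T.P.map (T.τ.app Y) ≫ T.z.app (T.P.obj (T.Q.obj Y))
  naturality _ _ f := by
    change T.P.map (T.Q.map f) ≫ _ = _ ≫ T.S.map (T.P.map (T.Q.map f))
    rw [← Category.assoc, ← T.P.map_comp, T.τ_nat, T.P.map_comp, Category.assoc, Category.assoc,
      T.z_nat]

/-- `θ^r = sPQ : PQ → SPQ`. -/
def θr : T.Q ⋙ T.P ⟶ (T.Q ⋙ T.P) ⋙ T.S where
  app Y := T.s.app (T.P.obj (T.Q.obj Y))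
  naturality _ _ f := T.s.naturality (T.P.map (T.Q.map f))

end

variable {A : Type u₁} [Category.{v₁} A] {B : Type u₂} [Category.{v₂} B]
  [HasEqualizers A] [HasEqualizers B] (T : TorsorContext A B)

/-! #### The comonad on `A` and its coaction on `Q` -/

/-- The functor `C`, the equalizer of `ω^l` and `ω^r`. -/
noncomputable def C : A ⥤ A := equalizer T.ωl T.ωr

/-- The inclusion `i : C → QP`. -/
noncomputable def i : T.C ⟶ T.P ⋙ T.Q := equalizer.ι T.ωl T.ωr

theorem i_isEqualizer : IsEqualizer T.i T.ωl T.ωr := IsEqualizer.equalizer_ι _ _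

theorem i_eq (X : A) : IsEqualizer (T.i.app X)
    (T.τ.app (T.P.obj X) ≫ T.Q.map (T.P.map (T.w.app X))) (T.Q.map (T.P.map (T.r.app X))) :=
  T.i_isEqualizer.app X

theorem i_nat {X X' : A} (f : X ⟶ X') :
    T.C.map f ≫ T.i.app X' = T.i.app X ≫ T.Q.map (T.P.map f) :=
  T.i.naturality f

instance presC : PreservesEqualizers T.C := T.i_isEqualizer.preserves

theorem c_aux (Y : B) :
    T.τ.app Y ≫ T.τ.app (T.P.obj (T.Q.obj Y)) ≫ T.Q.map (T.P.map (T.w.app (T.Q.obj Y))) =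
      T.τ.app Y ≫ T.Q.map (T.P.map (T.r.app (T.Q.obj Y))) := by
  rw [← reassoc_of% T.τ_coassoc, ← T.Q.map_comp, ← T.P.map_comp, T.τ_w]

/-- The coaction `c : Q → CQ`, determined by `(iQ)∘c = τ`. -/
noncomputable def c : T.Q ⟶ T.Q ⋙ T.C :=
  IsEqualizer.natLift (i := Functor.whiskerLeft T.Q T.i) (fun Y => T.i_eq (T.Q.obj Y)) T.τ T.c_aux

theorem c_i (Y : B) : T.c.app Y ≫ T.i.app (T.Q.obj Y) = T.τ.app Y :=
  IsEqualizer.natLift_app (i := Functor.whiskerLeft T.Q T.i) (fun Y => T.i_eq (T.Q.obj Y)) _ _ Y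

theorem c_nat {Y Y' : B} (f : Y ⟶ Y') : T.Q.map f ≫ T.c.app Y' = T.c.app Y ≫ T.C.map (T.Q.map f) :=
  T.c.naturality f

theorem ΔC_aux (X : A) :
    (T.i.app X ≫ T.c.app (T.P.obj X)) ≫
        T.C.map (T.τ.app (T.P.obj X) ≫ T.Q.map (T.P.map (T.w.app X))) =
      (T.i.app X ≫ T.c.app (T.P.obj X)) ≫ T.C.map (T.Q.map (T.P.map (T.r.app X))) := by
  apply (T.i_eq _).cancel
  try dsimp only [Functor.comp_obj, Functor.id_obj]
  have h := (T.i_eq X).condition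
  rw [Category.assoc, T.i_nat, Category.assoc, Category.assoc, T.i_nat]
  dsimp only [Functor.comp_obj, Functor.id_obj]
  simp only [Category.assoc, reassoc_of% T.c_i, Functor.map_comp]
  rw [reassoc_of% T.τ_coassoc, ← T.τ_nat, reassoc_of% h, ← T.τ_nat]

/-- The coproduct of `C`, determined by `(Ci)∘Δ = (cP)∘i`. -/
noncomputable def ΔC : T.C ⟶ T.C ⋙ T.C :=
  IsEqualizer.natLift (i := Functor.whiskerRight T.i T.C) (fun X => (T.i_eq X).map T.C)
    (T.i ≫ Functor.whiskerLeft T.P T.c) T.ΔC_aux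

theorem ΔC_i (X : A) : T.ΔC.app X ≫ T.C.map (T.i.app X) = T.i.app X ≫ T.c.app (T.P.obj X) :=
  IsEqualizer.natLift_app (i := Functor.whiskerRight T.i T.C) (fun X => (T.i_eq X).map T.C) _ _ X

/-- The coproduct satisfies `(ii)∘Δ = (τP)∘i`. -/
theorem ΔC_ii (X : A) :
    T.ΔC.app X ≫ T.i.app (T.C.obj X) ≫ T.Q.map (T.P.map (T.i.app X)) =
      T.i.app X ≫ T.τ.app (T.P.obj X) := by
  rw [← T.i_nat, reassoc_of% T.ΔC_i]
  dsimp only [Functor.comp_obj, Functor.id_obj]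
  rw [T.c_i]

theorem εC_aux (X : A) :
    (T.i.app X ≫ T.w.app X) ≫ T.r.app (T.R.obj X) =
      (T.i.app X ≫ T.w.app X) ≫ T.R.map (T.r.app X) := by
  have h := (T.i_eq X).condition
  have h2 := T.τ_w (T.P.obj X)
  try dsimp only [Functor.comp_obj, Functor.id_obj] at h h2 ⊢
  rw [Category.assoc, Category.assoc, ← T.w_nat, ← reassoc_of% h, T.w_nat, reassoc_of% h2, T.r_nat]

/-- The counit of `C`, determined by `r∘ε = w∘i`. -/
noncomputable def εC : T.C ⟶ 𝟭 A :=
  IsEqualizer.natLift T.r_eq (T.i ≫ T.w) T.εC_aux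

theorem εC_r (X : A) : T.εC.app X ≫ T.r.app X = T.i.app X ≫ T.w.app X :=
  IsEqualizer.natLift_app T.r_eq _ _ X

theorem εC_nat {X X' : A} (f : X ⟶ X') : T.C.map f ≫ T.εC.app X' = T.εC.app X ≫ f :=
  T.εC.naturality f

theorem ΔC_nat {X X' : A} (f : X ⟶ X') :
    T.C.map f ≫ T.ΔC.app X' = T.ΔC.app X ≫ T.C.map (T.C.map f) :=
  T.ΔC.naturality f

theorem c_counit (Y : B) : T.c.app Y ≫ T.εC.app (T.Q.obj Y) = 𝟙 (T.Q.obj Y) := by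
  apply (T.r_eq _).cancel
  try dsimp only [Functor.comp_obj, Functor.id_obj]
  rw [Category.assoc, T.εC_r, reassoc_of% T.c_i, T.τ_w, Category.id_comp]

theorem c_coassoc (Y : B) :
    T.c.app Y ≫ T.ΔC.app (T.Q.obj Y) = T.c.app Y ≫ T.C.map (T.c.app Y) := by
  apply ((T.i_eq (T.Q.obj Y)).map T.C).cancel
  try dsimp only [Functor.comp_obj, Functor.id_obj]
  rw [Category.assoc, Category.assoc, T.ΔC_i, reassoc_of% T.c_i, ← T.C.map_comp, T.c_i]
  apply (T.i_eq _).cancel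
  try dsimp only [Functor.comp_obj, Functor.id_obj]
  rw [Category.assoc, T.c_i, Category.assoc, T.i_nat, reassoc_of% T.c_i, T.τ_coassoc]

theorem ΔC_right (X : A) : T.ΔC.app X ≫ T.C.map (T.εC.app X) = 𝟙 (T.C.obj X) := by
  apply (T.i_eq X).cancel
  apply (((T.r_eq X).map T.P).map T.Q).cancel
  have h := (T.i_eq X).condition
  have h2 := T.i_nat (T.εC.app X)
  dsimp only [Functor.comp_obj, Functor.id_obj] at h h2 ⊢
  rw [Category.assoc, Category.assoc, reassoc_of% h2, ← T.Q.map_comp, ← T.P.map_comp,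
    T.εC_r, T.P.map_comp, T.Q.map_comp, reassoc_of% T.ΔC_ii, h, Category.id_comp]

theorem ΔC_left (X : A) : T.ΔC.app X ≫ T.εC.app (T.C.obj X) = 𝟙 (T.C.obj X) := by
  apply (T.i_eq X).cancel
  try dsimp only [Functor.comp_obj, Functor.id_obj]
  rw [Category.assoc, ← T.εC_nat, reassoc_of% T.ΔC_i, T.c_counit, Category.id_comp,
    Category.comp_id]

theorem ΔC_coassoc (X : A) :
    T.ΔC.app X ≫ T.C.map (T.ΔC.app X) = T.ΔC.app X ≫ T.ΔC.app (T.C.obj X) := by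
  apply (((T.i_eq X).map T.C).map T.C).cancel
  try dsimp only [Functor.comp_obj, Functor.id_obj]
  rw [Category.assoc, Category.assoc, ← T.C.map_comp, T.ΔC_i, T.C.map_comp, ← T.ΔC_nat,
    reassoc_of% T.ΔC_i, reassoc_of% T.ΔC_i, T.c_coassoc]

/-- The comonad on `A`. -/
noncomputable def comonadC : Comonad A where
  toFunctor := T.C
  ε := T.εC
  δ := T.ΔC
  coassoc := T.ΔC_coassoc
  left_counit := T.ΔC_left
  right_counit := T.ΔC_right

instance presComonadC : PreservesEqualizers T.comonadC.toFunctor := T.presC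

/-! #### The comonad on `B` and its coaction on `Q` -/

/-- The functor `D`, the equalizer of `θ^l` and `θ^r`. -/
noncomputable def D : B ⥤ B := equalizer T.θl T.θr

/-- The inclusion `j : D → PQ`. -/
noncomputable def j : T.D ⟶ T.Q ⋙ T.P := equalizer.ι T.θl T.θr

theorem j_isEqualizer : IsEqualizer T.j T.θl T.θr := IsEqualizer.equalizer_ι _ _

theorem j_eq (Y : B) : IsEqualizer (T.j.app Y)
    (T.P.map (T.τ.app Y) ≫ T.z.app (T.P.obj (T.Q.obj Y))) (T.s.app (T.P.obj (T.Q.obj Y))) :=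
  T.j_isEqualizer.app Y

theorem j_nat {Y Y' : B} (f : Y ⟶ Y') :
    T.D.map f ≫ T.j.app Y' = T.j.app Y ≫ T.P.map (T.Q.map f) :=
  T.j.naturality f

instance presD : PreservesEqualizers T.D := T.j_isEqualizer.preserves

theorem d_aux (Y : B) :
    T.τ.app Y ≫ T.Q.map (T.P.map (T.τ.app Y) ≫ T.z.app (T.P.obj (T.Q.obj Y))) =
      T.τ.app Y ≫ T.Q.map (T.s.app (T.P.obj (T.Q.obj Y))) := by
  rw [T.Q.map_comp, reassoc_of% T.τ_coassoc, T.τ_z]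

/-- The coaction `d : Q → QD`, determined by `(Qj)∘d = τ`. -/
noncomputable def d : T.Q ⟶ T.D ⋙ T.Q :=
  IsEqualizer.natLift (i := Functor.whiskerRight T.j T.Q) (fun Y => (T.j_eq Y).map T.Q) T.τ T.d_aux

theorem d_j (Y : B) : T.d.app Y ≫ T.Q.map (T.j.app Y) = T.τ.app Y :=
  IsEqualizer.natLift_app (i := Functor.whiskerRight T.j T.Q) (fun Y => (T.j_eq Y).map T.Q) _ _ Y

theorem d_nat {Y Y' : B} (f : Y ⟶ Y') : T.Q.map f ≫ T.d.app Y' = T.d.app Y ≫ T.Q.map (T.D.map f) :=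
  T.d.naturality f

theorem ΔD_aux (Y : B) :
    (T.j.app Y ≫ T.P.map (T.d.app Y)) ≫
        T.P.map (T.τ.app (T.D.obj Y)) ≫ T.z.app (T.P.obj (T.Q.obj (T.D.obj Y))) =
      (T.j.app Y ≫ T.P.map (T.d.app Y)) ≫ T.s.app (T.P.obj (T.Q.obj (T.D.obj Y))) := by
  apply ((((T.j_eq Y).map T.Q).map T.P).map T.S).cancel
  try dsimp only [Functor.comp_obj, Functor.id_obj]
  have h := (T.j_eq Y).condition
  simp only [Category.assoc]
  rw [← T.z_nat, ← T.s_nat, ← T.P.map_comp_assoc, ← T.P.map_comp_assoc, ← T.P.map_comp_assoc,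
    Category.assoc, ← T.τ_nat, reassoc_of% T.d_j, ← T.τ_coassoc, T.d_j, T.P.map_comp,
    Category.assoc]
  dsimp only [Functor.comp_obj, Functor.id_obj]
  rw [T.z_nat, reassoc_of% h, T.s_nat]

/-- The coproduct of `D`, determined by `(jD)∘Δ = (Pd)∘j`. -/
noncomputable def ΔD : T.D ⟶ T.D ⋙ T.D :=
  IsEqualizer.natLift (i := Functor.whiskerLeft T.D T.j) (fun Y => T.j_eq (T.D.obj Y))
    (T.j ≫ Functor.whiskerRight T.d T.P) T.ΔD_aux

theorem ΔD_j (Y : B) : T.ΔD.app Y ≫ T.j.app (T.D.obj Y) = T.j.app Y ≫ T.P.map (T.d.app Y) :=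
  IsEqualizer.natLift_app (i := Functor.whiskerLeft T.D T.j) (fun Y => T.j_eq (T.D.obj Y)) _ _ Y

/-- The coproduct satisfies `(jj)∘Δ = (Pτ)∘j`. -/
theorem ΔD_jj (Y : B) :
    T.ΔD.app Y ≫ T.j.app (T.D.obj Y) ≫ T.P.map (T.Q.map (T.j.app Y)) =
      T.j.app Y ≫ T.P.map (T.τ.app Y) := by
  rw [reassoc_of% T.ΔD_j, ← T.P.map_comp, T.d_j]

theorem εD_aux (Y : B) :
    (T.j.app Y ≫ T.z.app Y) ≫ T.s.app (T.S.obj Y) =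
      (T.j.app Y ≫ T.z.app Y) ≫ T.S.map (T.s.app Y) := by
  have h := (T.j_eq Y).condition
  rw [Category.assoc, Category.assoc, ← T.z_nat, T.s_nat]
  dsimp only [Functor.comp_obj, Functor.id_obj]
  rw [← reassoc_of% h, ← T.z_nat,
    ← T.P.map_comp_assoc, T.τ_z]

/-- The counit of `D`, determined by `s∘ε = z∘j`. -/
noncomputable def εD : T.D ⟶ 𝟭 B :=
  IsEqualizer.natLift T.s_eq (T.j ≫ T.z) T.εD_aux

theorem εD_s (Y : B) : T.εD.app Y ≫ T.s.app Y = T.j.app Y ≫ T.z.app Y :=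
  IsEqualizer.natLift_app T.s_eq _ _ Y

theorem εD_nat {Y Y' : B} (f : Y ⟶ Y') : T.D.map f ≫ T.εD.app Y' = T.εD.app Y ≫ f :=
  T.εD.naturality f

theorem ΔD_nat {Y Y' : B} (f : Y ⟶ Y') :
    T.D.map f ≫ T.ΔD.app Y' = T.ΔD.app Y ≫ T.D.map (T.D.map f) :=
  T.ΔD.naturality f

theorem d_counit (Y : B) : T.d.app Y ≫ T.Q.map (T.εD.app Y) = 𝟙 (T.Q.obj Y) := by
  apply ((T.s_eq Y).map T.Q).cancel
  try dsimp only [Functor.comp_obj, Functor.id_obj]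
  rw [Category.assoc, ← T.Q.map_comp, T.εD_s, T.Q.map_comp, reassoc_of% T.d_j, T.τ_z,
    Category.id_comp]

theorem d_coassoc (Y : B) :
    T.d.app Y ≫ T.Q.map (T.ΔD.app Y) = T.d.app Y ≫ T.d.app (T.D.obj Y) := by
  apply ((T.j_eq (T.D.obj Y)).map T.Q).cancel
  try dsimp only [Functor.comp_obj, Functor.id_obj]
  rw [Category.assoc, Category.assoc, ← T.Q.map_comp, T.ΔD_j, T.Q.map_comp, reassoc_of% T.d_j,
    T.d_j]
  apply ((((T.j_eq Y).map T.Q).map T.P).map T.Q).cancel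
  try dsimp only [Functor.comp_obj, Functor.id_obj]
  rw [Category.assoc, Category.assoc, ← T.Q.map_comp, ← T.P.map_comp, T.d_j, ← T.τ_nat,
    reassoc_of% T.d_j, T.τ_coassoc]

theorem ΔD_left (Y : B) : T.ΔD.app Y ≫ T.εD.app (T.D.obj Y) = 𝟙 (T.D.obj Y) := by
  apply (T.j_eq Y).cancel
  apply (T.s_eq _).cancel
  try dsimp only [Functor.comp_obj, Functor.id_obj]
  have h := (T.j_eq Y).condition
  rw [Category.assoc, Category.assoc, Category.assoc, T.s_nat, reassoc_of% T.εD_s, ← T.z_nat,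
    reassoc_of% T.ΔD_jj, h, Category.id_comp, ← T.s_nat]

theorem ΔD_right (Y : B) : T.ΔD.app Y ≫ T.D.map (T.εD.app Y) = 𝟙 (T.D.obj Y) := by
  apply (T.j_eq Y).cancel
  try dsimp only [Functor.comp_obj, Functor.id_obj]
  rw [Category.assoc, T.j_nat, reassoc_of% T.ΔD_j, ← T.P.map_comp, T.d_counit, T.P.map_id,
    Category.id_comp, Category.comp_id]

theorem ΔD_coassoc (Y : B) :
    T.ΔD.app Y ≫ T.D.map (T.ΔD.app Y) = T.ΔD.app Y ≫ T.ΔD.app (T.D.obj Y) := by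
  apply (T.j_eq _).cancel
  try dsimp only [Functor.comp_obj, Functor.id_obj]
  rw [Category.assoc, Category.assoc, T.j_nat, T.ΔD_j, reassoc_of% T.ΔD_j, reassoc_of% T.ΔD_j,
    ← T.P.map_comp, ← T.P.map_comp, T.d_coassoc]

/-- The comonad on `B`. -/
noncomputable def comonadD : Comonad B where
  toFunctor := T.D
  ε := T.εD
  δ := T.ΔD
  coassoc := T.ΔD_coassoc
  left_counit := T.ΔD_left
  right_counit := T.ΔD_right

instance presComonadD : PreservesEqualizers T.comonadD.toFunctor := T.presD

theorem c_d_comm (Y : B) :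
    T.c.app Y ≫ T.C.map (T.d.app Y) = T.d.app Y ≫ T.c.app (T.D.obj Y) := by
  apply (T.i_eq _).cancel
  apply ((((T.j_eq Y).map T.Q).map T.P).map T.Q).cancel
  try dsimp only [Functor.comp_obj, Functor.id_obj]
  simp only [Category.assoc]
  have h := T.i_nat (T.d.app Y)
  dsimp only [Functor.comp_obj] at h
  rw [reassoc_of% h, reassoc_of% T.c_i, reassoc_of% T.c_i, ← T.τ_nat, reassoc_of% T.d_j, ← T.Q.map_comp,
    ← T.P.map_comp, T.d_j, T.τ_coassoc]

/-- The functor `Q` as a `C`-`D` bicomodule functor, with coactions `c` and `d`. -/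
noncomputable def bicomoduleQ : Bicomodule T.comonadC T.comonadD where
  F := T.Q
  left := T.c
  right := T.d
  left_counit := T.c_counit
  left_coassoc := T.c_coassoc
  right_counit := T.d_counit
  right_coassoc := T.d_coassoc
  comm := T.c_d_comm

/-! #### The bicomodule functor `Q̄` -/

/-- The composite `(θ^l P)∘(Pi) : PC → SPQP`. -/
noncomputable def ql : T.C ⋙ T.P ⟶ T.P ⋙ (T.Q ⋙ T.P) ⋙ T.S :=
  Functor.whiskerRight T.i T.P ≫ Functor.whiskerLeft T.P T.θl

/-- The composite `(θ^r P)∘(Pi) : PC → SPQP`. -/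
noncomputable def qr : T.C ⋙ T.P ⟶ T.P ⋙ (T.Q ⋙ T.P) ⋙ T.S :=
  Functor.whiskerRight T.i T.P ≫ Functor.whiskerLeft T.P T.θr

/-- The functor `Q̄`, the equalizer of `(θ^l P)∘(Pi)` and `(θ^r P)∘(Pi)`. -/
noncomputable def Qbar : A ⥤ B := equalizer T.ql T.qr

/-- The inclusion `q : Q̄ → PC`. -/
noncomputable def q : T.Qbar ⟶ T.C ⋙ T.P := equalizer.ι T.ql T.qr

theorem q_eq (X : A) : IsEqualizer (T.q.app X)
    (T.P.map (T.i.app X) ≫ T.P.map (T.τ.app (T.P.obj X)) ≫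
      T.z.app (T.P.obj (T.Q.obj (T.P.obj X))))
    (T.P.map (T.i.app X) ≫ T.s.app (T.P.obj (T.Q.obj (T.P.obj X)))) :=
  (IsEqualizer.equalizer_ι T.ql T.qr).app X

theorem q_nat {X X' : A} (f : X ⟶ X') : T.Qbar.map f ≫ T.q.app X' = T.q.app X ≫ T.P.map (T.C.map f) :=
  T.q.naturality f

theorem q'_aux (X : A) :
    (T.q.app X ≫ T.P.map (T.i.app X)) ≫
        T.P.map (T.τ.app (T.P.obj X)) ≫ T.z.app (T.P.obj (T.Q.obj (T.P.obj X))) =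
      (T.q.app X ≫ T.P.map (T.i.app X)) ≫ T.s.app (T.P.obj (T.Q.obj (T.P.obj X))) := by
  rw [Category.assoc, Category.assoc, (T.q_eq X).condition]

/-- The inclusion `q' : Q̄ → DP`, determined by `(jP)∘q' = (Pi)∘q`. -/
noncomputable def q' : T.Qbar ⟶ T.P ⋙ T.D :=
  IsEqualizer.natLift (i := Functor.whiskerLeft T.P T.j) (fun X => T.j_eq (T.P.obj X))
    (T.q ≫ Functor.whiskerRight T.i T.P) T.q'_aux

theorem q'_j (X : A) : T.q'.app X ≫ T.j.app (T.P.obj X) = T.q.app X ≫ T.P.map (T.i.app X) :=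
  IsEqualizer.natLift_app (i := Functor.whiskerLeft T.P T.j) (fun X => T.j_eq (T.P.obj X)) _ _ X

theorem q'_nat {X X' : A} (f : X ⟶ X') :
    T.Qbar.map f ≫ T.q'.app X' = T.q'.app X ≫ T.D.map (T.P.map f) :=
  T.q'.naturality f

/-- `q'` is the equalizer of `(Pω^l)∘(jP)` and `(Pω^r)∘(jP)`. -/
theorem q'_eq (X : A) : IsEqualizer (T.q'.app X)
    (T.j.app (T.P.obj X) ≫ T.P.map (T.τ.app (T.P.obj X) ≫ T.Q.map (T.P.map (T.w.app X))))
    (T.j.app (T.P.obj X) ≫ T.P.map (T.Q.map (T.P.map (T.r.app X)))) := by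
  have hi := (T.i_eq X).map T.P
  have hj := (T.j_eq (T.P.obj X)).condition
  refine IsEqualizer.intro ?_ ⟨fun u v e => ?_⟩ fun k e => ?_
  · rw [reassoc_of% T.q'_j, reassoc_of% T.q'_j, hi.condition]
  · apply (T.q_eq X).cancel
    apply hi.cancel
    rw [Category.assoc, Category.assoc, ← T.q'_j, reassoc_of% e]
  · rw [← Category.assoc, ← Category.assoc] at e
    have e1 := hi.lift_comp _ e
    set m := hi.lift _ e
    have e2 : m ≫ T.P.map (T.i.app X) ≫ T.P.map (T.τ.app (T.P.obj X)) ≫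
          T.z.app (T.P.obj (T.Q.obj (T.P.obj X))) =
        m ≫ T.P.map (T.i.app X) ≫ T.s.app (T.P.obj (T.Q.obj (T.P.obj X))) := by
      rw [reassoc_of% e1, reassoc_of% e1, hj]
    refine ⟨(T.q_eq X).lift m e2, (T.j_eq _).cancel ?_⟩
    rw [Category.assoc, T.q'_j, reassoc_of% (T.q_eq X).lift_comp m e2, e1]

theorem cbar_aux (X : A) :
    (T.q.app X ≫ T.P.map (T.ΔC.app X)) ≫ T.P.map (T.i.app (T.C.obj X)) ≫
        T.P.map (T.τ.app (T.P.obj (T.C.obj X))) ≫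
          T.z.app (T.P.obj (T.Q.obj (T.P.obj (T.C.obj X)))) =
      (T.q.app X ≫ T.P.map (T.ΔC.app X)) ≫ T.P.map (T.i.app (T.C.obj X)) ≫
        T.s.app (T.P.obj (T.Q.obj (T.P.obj (T.C.obj X)))) := by
  apply (((((T.i_eq X).map T.P).map T.Q).map T.P).map T.S).cancel
  try dsimp only [Functor.comp_obj, Functor.id_obj]
  have h := (T.q_eq X).condition
  simp only [Category.assoc]
  rw [← T.z_nat, ← T.s_nat, ← T.P.map_comp_assoc (T.τ.app _), ← T.τ_nat, T.P.map_comp,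
    Category.assoc, ← T.P.map_comp_assoc (T.i.app _), ← T.P.map_comp_assoc (T.ΔC.app _),
    ← T.P.map_comp_assoc (T.i.app _), ← T.P.map_comp_assoc (T.ΔC.app _), T.ΔC_ii, T.P.map_comp,
    Category.assoc, Category.assoc, ← T.P.map_comp_assoc (T.τ.app _), ← T.τ_coassoc, T.P.map_comp,
    Category.assoc]
  dsimp only [Functor.comp_obj, Functor.id_obj]
  rw [T.z_nat, reassoc_of% h, T.s_nat]

/-- The right `C`-coaction on `Q̄`, determined by `(qC)∘c̄ = (PΔ)∘q`. -/
noncomputable def cbar : T.Qbar ⟶ T.C ⋙ T.Qbar :=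
  IsEqualizer.natLift (i := Functor.whiskerLeft T.C T.q) (fun X => T.q_eq (T.C.obj X))
    (T.q ≫ Functor.whiskerRight T.ΔC T.P) T.cbar_aux

theorem cbar_q (X : A) :
    T.cbar.app X ≫ T.q.app (T.C.obj X) = T.q.app X ≫ T.P.map (T.ΔC.app X) :=
  IsEqualizer.natLift_app (i := Functor.whiskerLeft T.C T.q) (fun X => T.q_eq (T.C.obj X)) _ _ X

theorem dbar_aux (X : A) :
    (T.q'.app X ≫ T.ΔD.app (T.P.obj X)) ≫
        T.D.map (T.j.app (T.P.obj X) ≫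
          T.P.map (T.τ.app (T.P.obj X) ≫ T.Q.map (T.P.map (T.w.app X)))) =
      (T.q'.app X ≫ T.ΔD.app (T.P.obj X)) ≫
        T.D.map (T.j.app (T.P.obj X) ≫ T.P.map (T.Q.map (T.P.map (T.r.app X)))) := by
  apply (T.j_eq _).cancel
  try dsimp only [Functor.comp_obj, Functor.id_obj]
  have h := ((T.i_eq X).map T.P).condition
  rw [Category.assoc, T.j_nat, Category.assoc, Category.assoc, T.j_nat]
  simp only [Functor.map_comp, Category.assoc] at h ⊢
  rw [reassoc_of% T.ΔD_jj, reassoc_of% T.ΔD_jj, reassoc_of% T.q'_j, reassoc_of% T.q'_j]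
  rw [← T.P.map_comp_assoc (T.τ.app _), T.τ_coassoc, T.P.map_comp, Category.assoc,
    ← T.P.map_comp (T.τ.app _) (T.Q.map (T.P.map (T.Q.map _))), ← T.τ_nat, T.P.map_comp,
    reassoc_of% h, ← T.P.map_comp, T.τ_nat, T.P.map_comp]

/-- The left `D`-coaction on `Q̄`, determined by `(Dq')∘d̄ = (ΔP)∘q'`. -/
noncomputable def dbar : T.Qbar ⟶ T.Qbar ⋙ T.D :=
  IsEqualizer.natLift (i := Functor.whiskerRight T.q' T.D) (fun X => (T.q'_eq X).map T.D)
    (T.q' ≫ Functor.whiskerLeft T.P T.ΔD) T.dbar_aux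

theorem dbar_q' (X : A) :
    T.dbar.app X ≫ T.D.map (T.q'.app X) = T.q'.app X ≫ T.ΔD.app (T.P.obj X) :=
  IsEqualizer.natLift_app (i := Functor.whiskerRight T.q' T.D) (fun X => (T.q'_eq X).map T.D) _ _ X

theorem cbar_counit (X : A) : T.cbar.app X ≫ T.Qbar.map (T.εC.app X) = 𝟙 (T.Qbar.obj X) := by
  apply (T.q_eq X).cancel
  try dsimp only [Functor.comp_obj, Functor.id_obj]
  rw [Category.assoc, T.q_nat, reassoc_of% T.cbar_q, ← T.P.map_comp, T.ΔC_right, T.P.map_id,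
    Category.comp_id, Category.id_comp]

theorem cbar_coassoc (X : A) :
    T.cbar.app X ≫ T.Qbar.map (T.ΔC.app X) = T.cbar.app X ≫ T.cbar.app (T.C.obj X) := by
  apply (T.q_eq _).cancel
  try dsimp only [Functor.comp_obj, Functor.id_obj]
  rw [Category.assoc, Category.assoc, T.q_nat, T.cbar_q, reassoc_of% T.cbar_q,
    reassoc_of% T.cbar_q, ← T.P.map_comp, ← T.P.map_comp, T.ΔC_coassoc]

theorem dbar_counit (X : A) : T.dbar.app X ≫ T.εD.app (T.Qbar.obj X) = 𝟙 (T.Qbar.obj X) := by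
  apply (T.q'_eq X).cancel
  try dsimp only [Functor.comp_obj, Functor.id_obj]
  rw [Category.assoc, ← T.εD_nat, reassoc_of% T.dbar_q', T.ΔD_left, Category.comp_id,
    Category.id_comp]

theorem dbar_coassoc (X : A) :
    T.dbar.app X ≫ T.ΔD.app (T.Qbar.obj X) = T.dbar.app X ≫ T.D.map (T.dbar.app X) := by
  apply (((T.q'_eq X).map T.D).map T.D).cancel
  try dsimp only [Functor.comp_obj, Functor.id_obj]
  rw [Category.assoc, Category.assoc, ← T.ΔD_nat, reassoc_of% T.dbar_q', ← T.D.map_comp, T.dbar_q',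
    T.D.map_comp, reassoc_of% T.dbar_q', T.ΔD_coassoc]

theorem dbar_j (X : A) :
    T.dbar.app X ≫ T.j.app (T.Qbar.obj X) ≫
        T.P.map (T.Q.map (T.q.app X)) ≫ T.P.map (T.Q.map (T.P.map (T.i.app X))) =
      T.q.app X ≫ T.P.map (T.i.app X) ≫ T.P.map (T.τ.app (T.P.obj X)) := by
  rw [← T.P.map_comp, ← T.Q.map_comp, ← T.q'_j, T.Q.map_comp, T.P.map_comp,
    ← reassoc_of% T.j_nat, reassoc_of% T.dbar_q']
  dsimp only [Functor.comp_obj, Functor.id_obj]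
  rw [T.ΔD_jj, reassoc_of% T.q'_j]

theorem dbar_cbar_comm (X : A) :
    T.dbar.app X ≫ T.D.map (T.cbar.app X) = T.cbar.app X ≫ T.dbar.app (T.C.obj X) := by
  apply (T.j_eq _).cancel
  apply (((T.q_eq _).map T.Q).map T.P).cancel
  apply ((((T.i_eq _).map T.P).map T.Q).map T.P).cancel
  apply ((((((T.i_eq X).map T.P).map T.Q).map T.P).map T.Q).map T.P).cancel
  try dsimp only [Functor.comp_obj, Functor.id_obj]
  have h := congrArg T.P.map (T.ΔC_ii X)
  have h2 := congrArg (fun f => T.P.map (T.Q.map f)) h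
  simp only [Functor.map_comp] at h h2
  simp only [Category.assoc]
  have h3 := congrArg (fun f => T.P.map (T.Q.map f)) (T.cbar_q X)
  simp only [Functor.map_comp] at h3
  rw [reassoc_of% T.j_nat, reassoc_of% h3, h2, reassoc_of% T.dbar_j, reassoc_of% T.dbar_j,
    reassoc_of% T.cbar_q, ← T.P.map_comp (T.τ.app (T.P.obj (T.C.obj X))), ← T.τ_nat, T.P.map_comp,
    reassoc_of% h, ← T.P.map_comp, T.τ_coassoc, T.P.map_comp]

/-- The functor `Q̄` as a `D`-`C` bicomodule functor. -/
noncomputable def bicomoduleQbar : Bicomodule T.comonadD T.comonadC where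
  F := T.Qbar
  left := T.dbar
  right := T.cbar
  left_counit := T.dbar_counit
  left_coassoc := T.dbar_coassoc
  right_counit := T.cbar_counit
  right_coassoc := T.cbar_coassoc
  comm := T.dbar_cbar_comm

/-- The functor `I_Q : B^D ⥤ A^C`. -/
noncomputable def IQ : T.comonadD.Coalgebra ⥤ T.comonadC.Coalgebra := T.bicomoduleQ.cotensor

/-- The functor `I_Q̄ : A^C ⥤ B^D`. -/
noncomputable def IQbar : T.comonadC.Coalgebra ⥤ T.comonadD.Coalgebra := T.bicomoduleQbar.cotensor

end TorsorContext

/-! The proof replaces `C`, `D` and `Q̄` by conditions stated inside `QP` and `PQ`. A comodule `X`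
over the comonad on `A` is recorded by a map `ρ : X → QPX` (`coactQP`), and a comodule `Y` over the
comonad on `B` by `ρ : Y → PQY` (`coactPQ`). The comodule axioms make `X` the equalizer of `τPX` and
`QPρ` (`coactQP_eq`). They also make `Y` the subobject of `PQY` on which `Pτ` agrees with `PQρ` and
`θ^l` agrees with `θ^r` (`coactPQ_mono`, `coactPQ_lift`).

The cotensor functors have descriptions of the same kind: `I_Q Y` is the equalizer of `τY` and `Qρ`
in `QY` (`inclQ_eq`), and `I_Q̄ X` is the equalizer of `(zPX)∘(Pρ)` and `sPX` in `PX` (`inclP_eq`).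

Since `P` and `Q` preserve these equalizers, `I_Q I_Q̄ X` is a subobject of `QPX` and `I_Q̄ I_Q Y` a
subobject of `PQY`. The torsor identities for `τ` show that they are cut out by the same equations
as `X` and `Y`, which gives the isomorphisms (`inclQP_eq`, `exists_unitIso`). Both inclusions are
monic and turn the coaction into `τ`, so compatibility with coactions and naturality can be checked
in iterated composites of `P` and `Q`. -/

/-- Monomorphisms that factor through each other have isomorphic sources. -/
theorem exists_iso_of_mono {K : Type*} [Category K] {E E' X : K} {i : E ⟶ X} {i' : E' ⟶ X}
    (hi : Mono i) (hi' : Mono i') (h : ∃ u, u ≫ i' = i) (h' : ∃ v, v ≫ i = i') :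
    ∃ e : E ≅ E', e.hom ≫ i' = i := by
  obtain ⟨u, hu⟩ := h
  obtain ⟨v, hv⟩ := h'
  exact ⟨⟨u, v, by rw [← cancel_mono i, Category.assoc, hv, hu, Category.id_comp],
    by rw [← cancel_mono i', Category.assoc, hu, hv, Category.id_comp]⟩, hu⟩

namespace IsEqualizer

variable {K : Type*} [Category K] {E E' X Y : K} {i : E ⟶ X} {i' : E' ⟶ X} {f g : X ⟶ Y}

/-- Two equalizers of the same parallel pair are isomorphic. -/
theorem exists_iso (h : IsEqualizer i f g) (h' : IsEqualizer i' f g) :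
    ∃ e : E ≅ E', e.hom ≫ i' = i :=
  exists_iso_of_mono h.mono h'.mono ⟨_, h'.lift_comp i h.condition⟩ ⟨_, h.lift_comp i' h'.condition⟩

/-- An equalizer is unchanged when the parallel pair is composed with a monomorphism. -/
theorem comp_mono {Z : K} (h : IsEqualizer i f g) {m : Y ⟶ Z} (hm : Mono m) :
    IsEqualizer i (f ≫ m) (g ≫ m) := by
  refine intro (by rw [reassoc_of% h.condition]) h.mono fun k e => ?_
  refine ⟨h.lift k ?_, h.lift_comp _ _⟩
  rwa [← Category.assoc, ← Category.assoc, cancel_mono] at e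

end IsEqualizer

namespace TorsorContext

variable {A : Type u₁} [Category.{v₁} A] {B : Type u₂} [Category.{v₂} B]
  [HasEqualizers A] [HasEqualizers B] (T : TorsorContext A B)

/-! ### Comodules in terms of the maps `X → QPX` and `Y → PQY` -/

/-- The coaction of a `C`-comodule. -/
def coactC (X : T.comonadC.Coalgebra) : X.A ⟶ T.C.obj X.A := X.a

/-- The coaction of a `D`-comodule. -/
def coactD (Y : T.comonadD.Coalgebra) : Y.A ⟶ T.D.obj Y.A := Y.a

theorem coactC_counit (X : T.comonadC.Coalgebra) : T.coactC X ≫ T.εC.app X.A = 𝟙 X.A :=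
  X.counit

theorem coactC_coassoc (X : T.comonadC.Coalgebra) :
    T.coactC X ≫ T.ΔC.app X.A = T.coactC X ≫ T.C.map (T.coactC X) :=
  X.coassoc

theorem coactC_hom {X X' : T.comonadC.Coalgebra} (f : X ⟶ X') :
    T.coactC X ≫ T.C.map f.f = f.f ≫ T.coactC X' :=
  f.h

theorem coactD_counit (Y : T.comonadD.Coalgebra) : T.coactD Y ≫ T.εD.app Y.A = 𝟙 Y.A :=
  Y.counit

theorem coactD_coassoc (Y : T.comonadD.Coalgebra) :
    T.coactD Y ≫ T.ΔD.app Y.A = T.coactD Y ≫ T.D.map (T.coactD Y) :=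
  Y.coassoc

theorem coactD_hom {Y Y' : T.comonadD.Coalgebra} (f : Y ⟶ Y') :
    T.coactD Y ≫ T.D.map f.f = f.f ≫ T.coactD Y' :=
  f.h

/-- The coaction of a `C`-comodule, followed by the inclusion `i : C → QP`. -/
noncomputable def coactQP (X : T.comonadC.Coalgebra) : X.A ⟶ T.Q.obj (T.P.obj X.A) :=
  T.coactC X ≫ T.i.app X.A

/-- The coaction of a `D`-comodule, followed by the inclusion `j : D → PQ`. -/
noncomputable def coactPQ (Y : T.comonadD.Coalgebra) : Y.A ⟶ T.P.obj (T.Q.obj Y.A) :=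
  T.coactD Y ≫ T.j.app Y.A

theorem coactQP_hom {X X' : T.comonadC.Coalgebra} (f : X ⟶ X') :
    f.f ≫ T.coactQP X' = T.coactQP X ≫ T.Q.map (T.P.map f.f) := by
  have h := T.i_nat f.f
  dsimp only [Functor.comp_obj] at h
  rw [coactQP, coactQP, Category.assoc, ← h, ← reassoc_of% T.coactC_hom]

theorem coactPQ_hom {Y Y' : T.comonadD.Coalgebra} (f : Y ⟶ Y') :
    f.f ≫ T.coactPQ Y' = T.coactPQ Y ≫ T.P.map (T.Q.map f.f) := by
  have h := T.j_nat f.f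
  dsimp only [Functor.comp_obj] at h
  rw [coactPQ, coactPQ, Category.assoc, ← h, ← reassoc_of% T.coactD_hom]

/-- The counit law, read through `r∘ε = w∘i`. -/
theorem coactQP_w (X : T.comonadC.Coalgebra) : T.coactQP X ≫ T.w.app X.A = T.r.app X.A := by
  have h := T.εC_r X.A
  dsimp only [Functor.comp_obj, Functor.id_obj] at h
  rw [coactQP, Category.assoc, ← h, reassoc_of% T.coactC_counit]

theorem coactPQ_z (Y : T.comonadD.Coalgebra) : T.coactPQ Y ≫ T.z.app Y.A = T.s.app Y.A := by
  have h := T.εD_s Y.A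
  dsimp only [Functor.comp_obj, Functor.id_obj] at h
  rw [coactPQ, Category.assoc, ← h, reassoc_of% T.coactD_counit]

/-- Coassociativity pushed into `QPQP` along `ii`, under which the coproduct becomes `τP`. -/
theorem coactQP_coassoc (X : T.comonadC.Coalgebra) :
    T.coactQP X ≫ T.τ.app (T.P.obj X.A) = T.coactQP X ≫ T.Q.map (T.P.map (T.coactQP X)) := by
  have h := T.ΔC_ii X.A
  have h2 := T.i_nat (T.coactC X)
  dsimp only [Functor.comp_obj] at h h2
  simp only [coactQP, Category.assoc, Functor.map_comp]
  rw [← h, reassoc_of% T.coactC_coassoc, reassoc_of% h2]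

theorem coactPQ_coassoc (Y : T.comonadD.Coalgebra) :
    T.coactPQ Y ≫ T.P.map (T.τ.app Y.A) = T.coactPQ Y ≫ T.P.map (T.Q.map (T.coactPQ Y)) := by
  have h := T.ΔD_jj Y.A
  have h2 := T.j_nat (T.coactD Y)
  dsimp only [Functor.comp_obj] at h h2
  simp only [coactPQ, Category.assoc, Functor.map_comp]
  rw [← h, reassoc_of% T.coactD_coassoc, reassoc_of% h2]

/-! ### Comodules as subobjects of `QPX` and `PQY` -/

/-- This is the split equalizer of a comodule, `X → CX ⇉ CCX`, transported to `QP`. The point is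
that the equation over `QPX` already forces a map into `QPX` to factor through `CX`. -/
theorem coactQP_eq (X : T.comonadC.Coalgebra) :
    IsEqualizer (T.coactQP X) (T.τ.app (T.P.obj X.A)) (T.Q.map (T.P.map (T.coactQP X))) := by
  have hi := T.i_eq X.A
  refine IsEqualizer.intro (T.coactQP_coassoc X) ⟨fun u v e => ?_⟩ fun k e => ?_
  · rw [coactQP, ← Category.assoc, ← Category.assoc] at e
    have := hi.cancel e =≫ T.εC.app X.A
    simpa only [Category.assoc, T.coactC_counit, Functor.id_obj, Category.comp_id] using this
  -- Composing the hypothesis on `k` with `QPw` and using `w∘ρ = r` yields exactly the condition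
  -- `ω^l = ω^r` that defines `C`.
  · have e1 : k ≫ T.τ.app (T.P.obj X.A) ≫ T.Q.map (T.P.map (T.w.app X.A)) =
        k ≫ T.Q.map (T.P.map (T.r.app X.A)) := by
      rw [reassoc_of% e, ← T.Q.map_comp, ← T.P.map_comp, T.coactQP_w]
    have e2 := hi.lift_comp k e1
    set l := hi.lift k e1
    dsimp only [Functor.comp_obj] at e2
    have e3 : l ≫ T.ΔC.app X.A = l ≫ T.C.map (T.coactC X) := by
      apply ((hi.map T.C)).cancel
      apply (T.i_eq _).cancel
      have h := T.ΔC_ii X.A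
      have h2 := T.i_nat (T.i.app X.A)
      have h3 := T.i_nat (T.coactC X)
      dsimp only [Functor.comp_obj] at h h2 h3 ⊢
      simp only [Category.assoc]
      rw [h2, h, reassoc_of% e2, e, reassoc_of% h3, reassoc_of% e2, coactQP, T.P.map_comp,
        T.Q.map_comp]
    -- The counit contracts the pair `Δ`, `C(coaction)`: applying `εC` to the equation for `l` shows
    -- that this composite followed by the coaction is `l` again.
    refine ⟨l ≫ T.εC.app X.A, ?_⟩
    have e4 := T.εC_nat (T.coactC X)
    have e5 := T.ΔC_left X.A
    dsimp only [Functor.comp_obj, Functor.id_obj] at e4 e5 ⊢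
    rw [coactQP, Category.assoc, ← reassoc_of% e4, ← reassoc_of% e3, reassoc_of% e5, e2]

theorem coactPQ_mono (Y : T.comonadD.Coalgebra) : Mono (T.coactPQ Y) := by
  refine ⟨fun u v e => ?_⟩
  rw [coactPQ, ← Category.assoc, ← Category.assoc] at e
  have := (T.j_eq Y.A).cancel e =≫ T.εD.app Y.A
  simpa only [Category.assoc, T.coactD_counit, Functor.id_obj, Category.comp_id] using this

/-- The argument of `coactQP_eq`, except that the factorization through `DY` is an extra assumption.
In `θ^l` the transformation `z` is applied outside `PQ`, so composing the first equation with `z`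
does not produce `θ^r`, whereas `w` sits inside `QP` in `ω^l`. -/
theorem coactPQ_lift (Y : T.comonadD.Coalgebra) {W : B} (k : W ⟶ T.P.obj (T.Q.obj Y.A))
    (e : k ≫ T.P.map (T.τ.app Y.A) = k ≫ T.P.map (T.Q.map (T.coactPQ Y)))
    (e1 : k ≫ T.P.map (T.τ.app Y.A) ≫ T.z.app (T.P.obj (T.Q.obj Y.A)) =
      k ≫ T.s.app (T.P.obj (T.Q.obj Y.A))) :
    ∃ l : W ⟶ Y.A, l ≫ T.coactPQ Y = k := by
  have hj := T.j_eq Y.A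
  have e2 := hj.lift_comp k e1
  set l := hj.lift k e1
  dsimp only [Functor.comp_obj] at e2
  have e3 : l ≫ T.ΔD.app Y.A = l ≫ T.D.map (T.coactD Y) := by
    apply (T.j_eq _).cancel
    apply (((hj.map T.Q)).map T.P).cancel
    have h := T.ΔD_jj Y.A
    have h3 := T.j_nat (T.coactD Y)
    dsimp only [Functor.comp_obj] at h h3 ⊢
    simp only [Category.assoc]
    rw [h, reassoc_of% e2, e, reassoc_of% h3, reassoc_of% e2, coactPQ, T.Q.map_comp,
      T.P.map_comp]
  refine ⟨l ≫ T.εD.app Y.A, ?_⟩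
  have e4 := T.εD_nat (T.coactD Y)
  have e5 := T.ΔD_left Y.A
  dsimp only [Functor.comp_obj, Functor.id_obj] at e4 e5 ⊢
  rw [coactPQ, Category.assoc, ← reassoc_of% e4, ← reassoc_of% e3, reassoc_of% e5, e2]

/-! ### The cotensor products -/

/-- The inclusion `I_Q Y → QY`. -/
noncomputable def inclQ (Y : T.comonadD.Coalgebra) : (T.IQ.obj Y).A ⟶ T.Q.obj Y.A :=
  T.bicomoduleQ.incl Y

/-- The inclusion `I_Q̄ X → Q̄X`. -/
noncomputable def inclQbar (X : T.comonadC.Coalgebra) : (T.IQbar.obj X).A ⟶ T.Qbar.obj X.A :=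
  T.bicomoduleQbar.incl X

/-- The defining pair of the cotensor product followed by the monomorphism `Qj`, which turns `d`
into `τ`. -/
theorem inclQ_eq (Y : T.comonadD.Coalgebra) :
    IsEqualizer (T.inclQ Y) (T.τ.app Y.A) (T.Q.map (T.coactPQ Y)) := by
  have h : IsEqualizer (T.inclQ Y) (T.d.app Y.A) (T.Q.map (T.coactD Y)) :=
    T.bicomoduleQ.incl_eq Y
  have h2 := h.comp_mono ((T.j_eq Y.A).map T.Q).mono
  have h3 := T.d_j Y.A
  dsimp only [Functor.comp_obj] at h2 h3
  rwa [h3, ← T.Q.map_comp] at h2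

theorem inclQ_coact (Y : T.comonadD.Coalgebra) :
    T.coactQP (T.IQ.obj Y) ≫ T.Q.map (T.P.map (T.inclQ Y)) = T.inclQ Y ≫ T.τ.app Y.A := by
  have h : T.coactC (T.IQ.obj Y) ≫ T.C.map (T.inclQ Y) = T.inclQ Y ≫ T.c.app Y.A :=
    T.bicomoduleQ.cotensorCoact_comp Y
  have h2 := T.i_nat (T.inclQ Y)
  have h3 := T.c_i Y.A
  dsimp only [Functor.comp_obj] at h2 h3
  rw [coactQP, Category.assoc, ← h2, reassoc_of% h, h3]

theorem inclQ_map {Y Y' : T.comonadD.Coalgebra} (f : Y ⟶ Y') :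
    (T.IQ.map f).f ≫ T.inclQ Y' = T.inclQ Y ≫ T.Q.map f.f :=
  T.bicomoduleQ.incl_naturality f

theorem inclQbar_eq (X : T.comonadC.Coalgebra) :
    IsEqualizer (T.inclQbar X) (T.cbar.app X.A) (T.Qbar.map (T.coactC X)) :=
  T.bicomoduleQbar.incl_eq X

theorem inclQbar_map {X X' : T.comonadC.Coalgebra} (f : X ⟶ X') :
    (T.IQbar.map f).f ≫ T.inclQbar X' = T.inclQbar X ≫ T.Qbar.map f.f :=
  T.bicomoduleQbar.incl_naturality f

theorem inclQbar_coact (X : T.comonadC.Coalgebra) :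
    T.coactD (T.IQbar.obj X) ≫ T.D.map (T.inclQbar X) = T.inclQbar X ≫ T.dbar.app X.A :=
  T.bicomoduleQbar.cotensorCoact_comp X

/-! ### The functor `I_Q̄` described inside `PX` -/

/-- The canonical map `I_Q̄ X → PX`. -/
noncomputable def inclP (X : T.comonadC.Coalgebra) : (T.IQbar.obj X).A ⟶ T.P.obj X.A :=
  T.inclQbar X ≫ T.q.app X.A ≫ T.P.map (T.εC.app X.A)

/-- On the cotensor product the coaction of `X` may be traded for `c̄`, hence for `PΔ`, and the
counit then cancels. So passing to `PX` loses nothing: the map to `PCX` is recovered by applying the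
coaction. -/
theorem inclP_coactC (X : T.comonadC.Coalgebra) :
    T.inclP X ≫ T.P.map (T.coactC X) = T.inclQbar X ≫ T.q.app X.A := by
  have h := (T.inclQbar_eq X).condition
  have h1 := T.cbar_q X.A
  have h2 := T.q_nat (T.coactC X)
  have h3 := T.εC_nat (T.coactC X)
  have h4 := T.ΔC_left X.A
  dsimp only [Functor.comp_obj, Functor.id_obj] at h1 h2 h3 h4
  rw [inclP, Category.assoc, Category.assoc, ← T.P.map_comp, ← h3, T.P.map_comp, ← reassoc_of% h2,
    ← reassoc_of% h, reassoc_of% h1, ← T.P.map_comp, h4]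
  exact congrArg (T.inclQbar X ≫ ·) ((congrArg (T.q.app X.A ≫ ·) (T.P.map_id _)).trans
    (Category.comp_id _))

theorem inclP_coactQP (X : T.comonadC.Coalgebra) :
    T.inclP X ≫ T.P.map (T.coactQP X) = T.inclQbar X ≫ T.q.app X.A ≫ T.P.map (T.i.app X.A) := by
  rw [coactQP, T.P.map_comp, reassoc_of% T.inclP_coactC]

theorem inclP_map {X X' : T.comonadC.Coalgebra} (f : X ⟶ X') :
    (T.IQbar.map f).f ≫ T.inclP X' = T.inclP X ≫ T.P.map f.f := by
  have h := T.q_nat f.f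
  have h2 := T.εC_nat f.f
  dsimp only [Functor.comp_obj, Functor.id_obj] at h h2
  rw [inclP, inclP, reassoc_of% T.inclQbar_map, reassoc_of% h, ← T.P.map_comp, h2, T.P.map_comp,
    Category.assoc, Category.assoc]

/-- Expresses the coaction of `I_Q̄ X` through that of `X`. It is checked after the monomorphism
`PQPρ`, where `d̄` becomes `Pτ` by `dbar_j` and coassociativity of `X` applies. -/
theorem inclP_coact (X : T.comonadC.Coalgebra) :
    T.coactPQ (T.IQbar.obj X) ≫ T.P.map (T.Q.map (T.inclP X)) =
      T.inclP X ≫ T.P.map (T.coactQP X) := by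
  apply ((((T.coactQP_eq X).map T.P).map T.Q).map T.P).cancel
  have h1 := T.dbar_j X.A
  have h2 := T.inclQbar_coact X
  have h3 := congrArg (fun f => T.P.map (T.Q.map f)) (T.inclP_coactQP X)
  have h4 := T.j_nat (T.inclQbar X)
  have h5 := T.inclP_coactQP X
  dsimp only [Functor.comp_obj] at h1 h4
  simp only [Functor.map_comp] at h3
  rw [Category.assoc, Category.assoc, h3, coactPQ, Category.assoc, ← reassoc_of% h4,
    reassoc_of% h2, h1, ← reassoc_of% h5, ← T.P.map_comp, T.coactQP_coassoc, T.P.map_comp]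

/-- Two nested equalizers, the one defining `Q̄` and the one defining the cotensor product, collapse
to one: coassociativity of `X` gives the cotensor condition for free, and the condition for `Q̄` is
the present one followed by the monomorphism `SPρ`. -/
theorem inclP_eq (X : T.comonadC.Coalgebra) :
    IsEqualizer (T.inclP X) (T.P.map (T.coactQP X) ≫ T.z.app (T.P.obj X.A))
      (T.s.app (T.P.obj X.A)) := by
  have hz := T.z_nat (T.P.map (T.coactQP X))
  have hs := T.s_nat (T.P.map (T.coactQP X))
  have hc := congrArg T.P.map (T.coactQP_coassoc X)
  simp only [T.P.map_comp] at hc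
  refine IsEqualizer.intro ?_ ⟨fun u v e => ?_⟩ fun k e => ?_
  · apply (((T.coactQP_eq X).map T.P).map T.S).cancel
    have h := (T.q_eq X.A).condition
    dsimp only [Functor.comp_obj] at h
    simp only [Category.assoc]
    rw [← hz, ← hs, ← reassoc_of% hc, reassoc_of% T.inclP_coactQP, reassoc_of% T.inclP_coactQP, h]
  · apply (T.inclQbar_eq X).cancel
    apply (T.q_eq X.A).cancel
    dsimp only [Functor.comp_obj]
    rw [Category.assoc, Category.assoc, ← T.inclP_coactC, reassoc_of% e]
  -- To lift `k`, first send it to `PCX` by the coaction; the result lies in `Q̄X` because `Pτ` can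
  -- be replaced by `PQPρ` and moved past `z`.
  · have e1 : (k ≫ T.P.map (T.coactC X)) ≫ T.P.map (T.i.app X.A) ≫
          T.P.map (T.τ.app (T.P.obj X.A)) ≫ T.z.app (T.P.obj (T.Q.obj (T.P.obj X.A))) =
        (k ≫ T.P.map (T.coactC X)) ≫ T.P.map (T.i.app X.A) ≫
          T.s.app (T.P.obj (T.Q.obj (T.P.obj X.A))) := by
      have h : T.P.map (T.coactC X) ≫ T.P.map (T.i.app X.A) = T.P.map (T.coactQP X) :=
        (T.P.map_comp _ _).symm
      dsimp only [Functor.comp_obj] at h ⊢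
      rw [Category.assoc, Category.assoc, reassoc_of% h, reassoc_of% h, reassoc_of% hc, hz,
        reassoc_of% e, hs]
    have e2 := (T.q_eq X.A).lift_comp _ e1
    set l := (T.q_eq X.A).lift _ e1
    have e3 : l ≫ T.cbar.app X.A = l ≫ T.Qbar.map (T.coactC X) := by
      apply (T.q_eq _).cancel
      have h1 := T.cbar_q X.A
      have h2 := T.q_nat (T.coactC X)
      dsimp only [Functor.comp_obj] at e2 h1 h2 ⊢
      rw [Category.assoc, Category.assoc, h1, h2, reassoc_of% e2, reassoc_of% e2, ← T.P.map_comp,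
        ← T.P.map_comp, T.coactC_coassoc]
    refine ⟨(T.inclQbar_eq X).lift l e3, ?_⟩
    have e4 := (T.inclQbar_eq X).lift_comp l e3
    dsimp only [Functor.comp_obj] at e2
    rw [inclP, reassoc_of% e4, reassoc_of% e2, ← T.P.map_comp, T.coactC_counit, T.P.map_id]
    exact Category.comp_id _

/-! ### The unit -/

/-- The canonical map `I_Q̄ I_Q Y → PQY`. -/
noncomputable def inclPQ (Y : T.comonadD.Coalgebra) :
    (T.IQbar.obj (T.IQ.obj Y)).A ⟶ T.P.obj (T.Q.obj Y.A) :=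
  T.inclP (T.IQ.obj Y) ≫ T.P.map (T.inclQ Y)

theorem inclPQ_mono (Y : T.comonadD.Coalgebra) : Mono (T.inclPQ Y) := by
  have := (T.inclP_eq (T.IQ.obj Y)).mono
  have := ((T.inclQ_eq Y).map T.P).mono
  exact mono_comp _ _

theorem inclPQ_coact (Y : T.comonadD.Coalgebra) :
    T.coactPQ (T.IQbar.obj (T.IQ.obj Y)) ≫ T.P.map (T.Q.map (T.inclPQ Y)) =
      T.inclPQ Y ≫ T.P.map (T.τ.app Y.A) := by
  rw [inclPQ, T.Q.map_comp, T.P.map_comp, reassoc_of% T.inclP_coact, Category.assoc,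
    ← T.P.map_comp, ← T.P.map_comp, T.inclQ_coact]

theorem inclPQ_map {Y Y' : T.comonadD.Coalgebra} (f : Y ⟶ Y') :
    (T.IQbar.map (T.IQ.map f)).f ≫ T.inclPQ Y' = T.inclPQ Y ≫ T.P.map (T.Q.map f.f) := by
  rw [inclPQ, inclPQ, reassoc_of% T.inclP_map, Category.assoc, ← T.P.map_comp, ← T.P.map_comp,
    T.inclQ_map]

/-- The two subobjects of `PQY` contain each other. The equations defining `I_Q̄ I_Q Y`, moved into
`PQY`, are precisely the two assumptions of `coactPQ_lift`. -/
theorem exists_unitIso (Y : T.comonadD.Coalgebra) :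
    ∃ e : Y.A ≅ (T.IQbar.obj (T.IQ.obj Y)).A, e.hom ≫ T.inclPQ Y = T.coactPQ Y := by
  have hQ := congrArg T.P.map (T.inclQ_coact Y)
  simp only [T.P.map_comp] at hQ
  refine exists_iso_of_mono (T.coactPQ_mono Y) (T.inclPQ_mono Y) ?_ ?_
  · have hP := (T.inclQ_eq Y).map T.P
    have e1 := hP.lift_comp _ (T.coactPQ_coassoc Y)
    set l := hP.lift _ (T.coactPQ_coassoc Y)
    -- After the monomorphism `SP` of the inclusion `I_Q Y → QY`, this becomes `θ^l∘ρ = θ^r∘ρ`,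
    -- which follows from coassociativity and `z∘ρ = s`.
    have e2 : l ≫ T.P.map (T.coactQP (T.IQ.obj Y)) ≫ T.z.app (T.P.obj (T.IQ.obj Y).A) =
        l ≫ T.s.app (T.P.obj (T.IQ.obj Y).A) := by
      apply (hP.map T.S).cancel
      rw [Category.assoc, Category.assoc, Category.assoc, ← T.z_nat, ← T.s_nat, reassoc_of% hQ,
        reassoc_of% e1, reassoc_of% e1, reassoc_of% T.coactPQ_coassoc, T.z_nat,
        reassoc_of% T.coactPQ_z, T.s_nat]
    have e3 := (T.inclP_eq (T.IQ.obj Y)).lift_comp l e2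
    exact ⟨_, by rw [inclPQ, reassoc_of% e3, e1]⟩
  · refine T.coactPQ_lift Y _ ?_ ?_
    · rw [inclPQ, Category.assoc, Category.assoc, ((T.inclQ_eq Y).map T.P).condition]
    · have h := (T.inclP_eq (T.IQ.obj Y)).condition
      rw [inclPQ, Category.assoc, Category.assoc, ← reassoc_of% hQ, T.z_nat, reassoc_of% h, T.s_nat]

/-- A comodule is isomorphic to its image under `I_Q̄ I_Q`. -/
noncomputable def unitIsoApp (Y : T.comonadD.Coalgebra) : Y ≅ T.IQbar.obj (T.IQ.obj Y) :=
  Comonad.Coalgebra.isoMk (T.exists_unitIso Y).choose (by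
    have hu := (T.exists_unitIso Y).choose_spec
    set u := (T.exists_unitIso Y).choose
    have hu2 := congrArg (fun f => T.P.map (T.Q.map f)) hu
    have hj := T.j_nat u.hom
    simp only [Functor.map_comp] at hu2
    dsimp only [Functor.comp_obj] at hj
    change T.coactD Y ≫ T.D.map u.hom = u.hom ≫ T.coactD _
    apply (T.j_eq _).cancel
    -- After this monomorphism, compatibility with the coactions is the coassociativity of `Y`.
    have hm : Mono (T.P.map (T.Q.map (T.inclPQ Y))) := by
      have h1 := ((((T.inclP_eq (T.IQ.obj Y)).map T.Q).map T.P)).mono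
      have h2 := ((((T.inclQ_eq Y).map T.P).map T.Q).map T.P).mono
      rw [inclPQ, T.Q.map_comp, T.P.map_comp]
      exact mono_comp _ _
    apply hm.right_cancellation
    have h := T.inclPQ_coact Y
    dsimp only [Functor.comp_obj]
    simp only [coactPQ, Category.assoc] at h
    rw [Category.assoc, Category.assoc, Category.assoc, Category.assoc, reassoc_of% hj, hu2, h,
      reassoc_of% hu, T.coactPQ_coassoc, coactPQ, Category.assoc])

theorem unitIsoApp_hom_inclPQ (Y : T.comonadD.Coalgebra) :
    (T.unitIsoApp Y).hom.f ≫ T.inclPQ Y = T.coactPQ Y :=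
  (T.exists_unitIso Y).choose_spec

/-- The natural isomorphism from the identity to `I_Q̄ I_Q`. -/
noncomputable def unitIso : 𝟭 T.comonadD.Coalgebra ≅ T.IQ ⋙ T.IQbar :=
  NatIso.ofComponents T.unitIsoApp (fun {Y Y'} f => by
    ext
    apply (T.inclPQ_mono Y').right_cancellation
    change (f.f ≫ (T.unitIsoApp Y').hom.f) ≫ _ =
      ((T.unitIsoApp Y).hom.f ≫ (T.IQbar.map (T.IQ.map f)).f) ≫ _
    rw [Category.assoc, Category.assoc, T.unitIsoApp_hom_inclPQ, T.inclPQ_map,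
      reassoc_of% T.unitIsoApp_hom_inclPQ, T.coactPQ_hom])

/-! ### The counit -/

/-- The canonical map `I_Q I_Q̄ X → QPX`. -/
noncomputable def inclQP (X : T.comonadC.Coalgebra) :
    (T.IQ.obj (T.IQbar.obj X)).A ⟶ T.Q.obj (T.P.obj X.A) :=
  T.inclQ (T.IQbar.obj X) ≫ T.Q.map (T.inclP X)

theorem inclQP_coact (X : T.comonadC.Coalgebra) :
    T.coactQP (T.IQ.obj (T.IQbar.obj X)) ≫ T.Q.map (T.P.map (T.inclQP X)) =
      T.inclQP X ≫ T.τ.app (T.P.obj X.A) := by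
  rw [inclQP, T.P.map_comp, T.Q.map_comp, reassoc_of% T.inclQ_coact, Category.assoc, T.τ_nat]

theorem inclQP_map {X X' : T.comonadC.Coalgebra} (f : X ⟶ X') :
    (T.IQ.map (T.IQbar.map f)).f ≫ T.inclQP X' = T.inclQP X ≫ T.Q.map (T.P.map f.f) := by
  rw [inclQP, inclQP, reassoc_of% T.inclQ_map, Category.assoc, ← T.Q.map_comp, ← T.Q.map_comp,
    T.inclP_map]

/-- The parallel pair is the one in `coactQP_eq`, so uniqueness of equalizers identifies `I_Q I_Q̄
X` with `X`. -/
theorem inclQP_eq (X : T.comonadC.Coalgebra) :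
    IsEqualizer (T.inclQP X) (T.τ.app (T.P.obj X.A)) (T.Q.map (T.P.map (T.coactQP X))) := by
  have hP := (T.inclP_eq X).map T.Q
  have hc := congrArg T.Q.map (T.inclP_coact X)
  simp only [T.Q.map_comp] at hc
  have hQ := T.inclQ_eq (T.IQbar.obj X)
  have hm := ((hP.map T.P).map T.Q).mono
  refine IsEqualizer.intro ?_ ?_ fun k e => ?_
  · rw [inclQP, Category.assoc, Category.assoc, T.τ_nat, reassoc_of% hQ.condition, hc]
  · have := hP.mono
    have := hQ.mono
    exact mono_comp _ _
  -- Under `Q` the condition defining `I_Q̄ X` follows from the other equation: replace `QPρ` by `τ`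
  -- and use `(Qz)∘τ = Qs`.
  · have e1 : k ≫ T.Q.map (T.P.map (T.coactQP X) ≫ T.z.app (T.P.obj X.A)) =
        k ≫ T.Q.map (T.s.app (T.P.obj X.A)) := by
      rw [T.Q.map_comp, ← reassoc_of% e, T.τ_z]
    have e2 := hP.lift_comp k e1
    set l := hP.lift k e1
    have e3 : l ≫ T.τ.app (T.IQbar.obj X).A =
        l ≫ T.Q.map (T.coactPQ (T.IQbar.obj X)) := by
      apply hm.right_cancellation
      rw [Category.assoc, Category.assoc, ← T.τ_nat, hc, reassoc_of% e2, reassoc_of% e2, e]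
    exact ⟨hQ.lift l e3, by rw [inclQP, reassoc_of% hQ.lift_comp l e3, e2]⟩

/-- A comodule is isomorphic to its image under `I_Q I_Q̄`. -/
noncomputable def counitIsoApp (X : T.comonadC.Coalgebra) : X ≅ T.IQ.obj (T.IQbar.obj X) :=
  Comonad.Coalgebra.isoMk ((T.coactQP_eq X).exists_iso (T.inclQP_eq X)).choose (by
    have hu := ((T.coactQP_eq X).exists_iso (T.inclQP_eq X)).choose_spec
    set u := ((T.coactQP_eq X).exists_iso (T.inclQP_eq X)).choose
    have hu2 := congrArg (fun f => T.Q.map (T.P.map f)) hu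
    have hi := T.i_nat u.hom
    simp only [Functor.map_comp] at hu2
    dsimp only [Functor.comp_obj] at hi
    change T.coactC X ≫ T.C.map u.hom = u.hom ≫ T.coactC _
    apply (T.i_eq _).cancel
    apply (((T.inclQP_eq X).map T.P).map T.Q).cancel
    have h := T.inclQP_coact X
    dsimp only [Functor.comp_obj]
    simp only [coactQP, Category.assoc] at h
    rw [Category.assoc, Category.assoc, Category.assoc, Category.assoc, reassoc_of% hi, hu2, h,
      reassoc_of% hu, T.coactQP_coassoc, coactQP, Category.assoc])

theorem counitIsoApp_hom_inclQP (X : T.comonadC.Coalgebra) :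
    (T.counitIsoApp X).hom.f ≫ T.inclQP X = T.coactQP X :=
  ((T.coactQP_eq X).exists_iso (T.inclQP_eq X)).choose_spec

/-- The natural isomorphism from the identity to `I_Q I_Q̄`. -/
noncomputable def counitIso : 𝟭 T.comonadC.Coalgebra ≅ T.IQbar ⋙ T.IQ :=
  NatIso.ofComponents T.counitIsoApp (fun {X X'} f => by
    ext
    apply (T.inclQP_eq X').cancel
    change (f.f ≫ (T.counitIsoApp X').hom.f) ≫ _ =
      ((T.counitIsoApp X).hom.f ≫ (T.IQ.map (T.IQbar.map f)).f) ≫ _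
    rw [Category.assoc, Category.assoc, T.counitIsoApp_hom_inclQP, T.inclQP_map,
      reassoc_of% T.counitIsoApp_hom_inclQP, T.coactQP_hom])

end TorsorContext

theorem theorem5p3 {A : Type u₁} [Category.{v₁} A] {B : Type u₂} [Category.{v₂} B]
    [HasEqualizers A] [HasEqualizers B] (T : TorsorContext A B) :
    ∃ e : T.comonadD.Coalgebra ≌ T.comonadC.Coalgebra,
      e.functor = T.IQ ∧ e.inverse = T.IQbar := by
  -- `Equivalence.mk` adjusts only the unit to obtain the triangle identity, so both functors are
  -- kept definitionally. No compatibility between the two isomorphisms is needed.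
  exact ⟨CategoryTheory.Equivalence.mk T.IQ T.IQbar T.unitIso T.counitIso.symm, rfl, rfl⟩
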